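/- Let $\mathcal V$ be a finite or countably infinite vocabulary. The token tree has as nodes the finite sequences $v=(x_1,\dots,x_d)$ of tokens, $d\ge 0$ (continuations of the currently known prefix); its root $r$ is the empty sequence. To every node $s$ is attached a random probability distribution $\beta(\cdot\mid s)$ on $\mathcal V$, the next-token distribution of the target model after $s$, and these random distributions are i.i.d. across the nodes $s$. Write $(\beta_x)_{x\in\mathcal V}$ for one of them and put (natural logarithms, $0\log 0=0\log^2 0=0$) \[ \mu=\mathbb E\Big[-\sum_{x\in\mathcal V}\beta_x\log\beta_x\Big],\qquad \mu_{(2)}=\mathbb E\Big[\sum_{x\in\mathcal V}\beta_x\log^2\beta_x\Big]. \] In one speculative iteration with parallel token capacity $P\in\mathbb N$, a deterministic drafter, which may know the whole realised token tree, chooses as a function of that tree a draft tree: a set of at most $P$ nodes that contains $r$ and, with every other node in it, the parent of that node. Given the token tree, and independently of anything else, the target model then generates tokens $x_1,x_2,\dots$, where $x_{d+1}$ has law $\beta(\cdot\mid x_1,\dots,x_d)$ given $x_1,\dots,x_d$; a node is accepted if it is an initial segment of this sequence. Let $X$ be the number of nodes, including $r$, on the longest accepted path of the draft tree (equivalently,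 the number of accepted draft tokens plus the one new token produced by the target model), and let $\mathbb E[X]$ be its expectation over both the token tree and the generated tokens. \textbf{Theorem.} Assume $\mu>0$ and $\mu_{(2)}<\infty$, and let $a=\dfrac{\mu+\mu_{(2)}}{\mu^2}$ and $b=1-\dfrac1\mu$. Then for every integer $P\ge 1+\dfrac{\mu_{(2)}}{\mu^2}$ and every deterministic drafter of capacity $P$, \[ \mathbb E[X]\le a\ln\Big(\frac{P-b}{a}\Big)+a+b . \] In particular, there is a constant $C$, depending on the law of the next-token distributions but not on $P$ or on the drafter, such that for all such $P$ and all such drafters \[ \mathbb E[X]\le\frac{\mu+\mu_{(2)}}{\mu^2}\log P+C . \] -/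

import Mathlib

open MeasureTheory ProbabilityTheory
open scoped ENNReal

noncomputable section

namespace SpecGen

/-- A realised token tree over the vocabulary `V`. Its nodes are the finite continuations
`s = [x₁, …, x_d]` of the currently known prefix (the root is `[]`, the depth of a node is its
length), and `u s v` is the acceptance probability of the child `s ++ [v]` given that `s` is
accepted, that is, the probability that the target model generates `v` after `s`. -/
abbrev TokenTree (V : Type*) := List V → PMF V

/-- The law of the first `n` tokens that the target model generates after the current prefix:
each new token is drawn from the distribution attached to the tokens generated so far. -/
def genTokens {V : Type*} (u : TokenTree V) : ℕ → PMF (List V)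
  | 0 => PMF.pure []
  | n + 1 => (genTokens u n).bind fun s => (u s).map fun v => s ++ [v]

/-- A draft tree of capacity `P`: a subtree of the token tree that is rooted at the root and has at
most `P` nodes, the root included. -/
structure IsDraftTree {V : Type*} (P : ℕ) (D : Finset (List V)) : Prop where
  root_mem : [] ∈ D
  parent_mem : ∀ (s : List V) (v : V), s ++ [v] ∈ D → s ∈ D
  card_le : D.card ≤ P

open Classical in
/-- The number of nodes, the root included, of the longest path of `D` that is accepted when the
target model generates the tokens `s`; a node is accepted when it is an initial segment of `s`.
The root counts for the one new token that the target model adds in every verification. -/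
def acceptedLength {V : Type*} (D : Finset (List V)) (s : List V) : ℕ :=
  (D.filter fun x => x <+: s).sup fun x => x.length + 1

/-- The expectation, over the randomness of the verification, of the number of tokens obtained in
one iteration from the draft tree `D` on the token tree `u`. The target model is run for `P` tokens;
all nodes of a draft tree of capacity `P` have depth less than `P`, so no later token matters. -/
def verifExpectation {V : Type*} (P : ℕ) (u : TokenTree V) (D : Finset (List V)) : ℝ≥0∞ :=
  ∑' s : List V, genTokens u P s * (acceptedLength D s : ℝ≥0∞)

/-- A random token tree whose next-token distributions are i.i.d. across the different prefixes.
Nothing is assumed about the joint law of the probabilities of different tokens after the same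
prefix. -/
structure IsIIDTokenTree {V Ω : Type*} [MeasurableSpace Ω] (Pr : Measure Ω)
    (β : Ω → TokenTree V) : Prop where
  measurable : ∀ s : List V, Measurable fun ω => (⇑(β ω s) : V → ℝ≥0∞)
  indep : iIndepFun (fun (s : List V) (ω : Ω) => (⇑(β ω s) : V → ℝ≥0∞)) Pr
  identDistrib : ∀ s : List V,
    IdentDistrib (fun ω => (⇑(β ω s) : V → ℝ≥0∞)) (fun ω => (⇑(β ω []) : V → ℝ≥0∞)) Pr Pr

/-- The entropy `-∑ p(v) log p(v)` (natural logarithm, `0 log 0 = 0`), in `[0, ∞]`. -/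
def entropy {V : Type*} (p : PMF V) : ℝ≥0∞ :=
  ∑' v, ENNReal.ofReal (Real.negMulLog (p v).toReal)

/-- The second log-moment `∑ p(v) log² p(v)`, in `[0, ∞]`. -/
def secondLogMoment {V : Type*} (p : PMF V) : ℝ≥0∞ :=
  ∑' v, ENNReal.ofReal ((p v).toReal * Real.log (p v).toReal ^ 2)

/-- The expected entropy `μ` of the next-token distribution. -/
def expectedEntropy {V Ω : Type*} [MeasurableSpace Ω] (Pr : Measure Ω) (β : Ω → TokenTree V) :
    ℝ≥0∞ :=
  ∫⁻ ω, entropy (β ω []) ∂Pr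

/-- The expected second log-moment `μ₍₂₎` of the next-token distribution. -/
def expectedSecondLogMoment {V Ω : Type*} [MeasurableSpace Ω] (Pr : Measure Ω)
    (β : Ω → TokenTree V) : ℝ≥0∞ :=
  ∫⁻ ω, secondLogMoment (β ω []) ∂Pr

/-- `E[X]`: the expected number of tokens obtained in one iteration by a deterministic drafter,
which maps each token tree to a draft tree. The expectation is over the verification and over the
random token tree. -/
def expectedTokens {V Ω : Type*} [MeasurableSpace Ω] (Pr : Measure Ω) (β : Ω → TokenTree V)
    (P : ℕ) (draft : TokenTree V → Finset (List V)) : ℝ≥0∞ :=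
  ∫⁻ ω, verifExpectation P (β ω) (draft (β ω)) ∂Pr

end SpecGen

end

/-! ### Renewal measures on the half-line -/

namespace SpecGen

/-! The expected accepted length is at most the expected sum of the acceptance probabilities `p` of
the nodes of the draft tree. For any level `exp (-τ)`, each `p` is at most `exp (-τ)` plus the
positive part of `p - exp (-τ)`. The first terms cost at most `P * exp (-τ)`. The positive parts may
be summed over the whole token tree, which removes the drafter from the problem, however much it
knows (`verifExpectation_le`).

The expected total excess is a renewal quantity. A node of depth `n`, weighted by its probability,
has as surprisal `-log p` a sum of `n` independent steps with mean `μ` and second moment `μ₂`. Hence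
the expected sum of `p * f (-log p)` over all nodes is the integral of `f` against the renewal
measure of these steps (`lintegral_tsum_nodeProb`).

Lorden's inequality bounds the renewal function by `t / μ + μ₂ / μ ^ 2` (`renewalMeasure_Iic_le`).
Its proof combines subadditivity of the renewal function with the nonnegativity of a variance.
Partial integration turns it into a bound on the excess (`lintegral_excess_renewalMeasure_le`), and
`τ` is then optimised. -/

/-- The law of the sum of `n` independent variables of law `F`. -/
noncomputable def convPow (F : Measure ℝ) : ℕ → Measure ℝ
  | 0 => Measure.dirac 0
  | n + 1 => F ∗ convPow F n

/-- The renewal measure of the step distribution `F`, the epoch `0` included. -/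
noncomputable def renewalMeasure (F : Measure ℝ) : Measure ℝ :=
  Measure.sum (convPow F)

lemma lintegral_renewalMeasure (F : Measure ℝ) (f : ℝ → ℝ≥0∞) :
    ∫⁻ y, f y ∂renewalMeasure F = ∑' n, ∫⁻ y, f y ∂convPow F n := by
  rw [renewalMeasure, lintegral_sum_measure]

lemma renewalMeasure_apply (F : Measure ℝ) {s : Set ℝ} (hs : MeasurableSet s) :
    renewalMeasure F s = ∑' n, convPow F n s := by
  rw [renewalMeasure, Measure.sum_apply _ hs]

section Renewal

variable {F : Measure ℝ} [IsProbabilityMeasure F]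

instance isProbabilityMeasure_convPow (n : ℕ) : IsProbabilityMeasure (convPow F n) := by
  induction n with
  | zero => exact inferInstanceAs (IsProbabilityMeasure (Measure.dirac (0 : ℝ)))
  | succ n ih => exact inferInstanceAs (IsProbabilityMeasure (F ∗ convPow F n))

instance sFinite_renewalMeasure : SFinite (renewalMeasure F) := by
  unfold renewalMeasure; infer_instance

/-- Splits off the last step, as a token is appended to a node; `convPow_succ_Iic` splits off the
first step instead, as subadditivity requires. -/
lemma lintegral_convPow_succ (n : ℕ) {f : ℝ → ℝ≥0∞} (hf : Measurable f) :
    ∫⁻ y, f y ∂convPow F (n + 1) = ∫⁻ y, ∫⁻ x, f (y + x) ∂F ∂convPow F n := by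
  change ∫⁻ y, f y ∂(F ∗ convPow F n) = _
  rw [Measure.conv_comm, Measure.lintegral_conv hf]

lemma convPow_succ_Iic (n : ℕ) (t : ℝ) :
    convPow F (n + 1) (Set.Iic t) = ∫⁻ x, convPow F n (Set.Iic (t - x)) ∂F := by
  rw [← lintegral_indicator_one measurableSet_Iic]
  change ∫⁻ y, _ ∂(F ∗ convPow F n) = _
  rw [Measure.lintegral_conv (measurable_one.indicator measurableSet_Iic)]
  refine lintegral_congr fun x => ?_
  rw [← lintegral_indicator_one measurableSet_Iic]
  refine lintegral_congr fun y => ?_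
  simp [Set.indicator_apply, le_sub_iff_add_le']

/-- The renewal equation. -/
lemma lintegral_renewalMeasure_eq_add {f : ℝ → ℝ≥0∞} (hf : Measurable f) :
    ∫⁻ y, f y ∂renewalMeasure F = f 0 + ∫⁻ y, ∫⁻ x, f (y + x) ∂F ∂renewalMeasure F := by
  rw [lintegral_renewalMeasure, lintegral_renewalMeasure, tsum_eq_zero_add' ENNReal.summable]
  congr 1
  · exact lintegral_dirac' 0 hf
  · exact tsum_congr fun n => lintegral_convPow_succ n hf

lemma ae_nonneg_convPow (hF : ∀ᵐ x ∂F, 0 ≤ x) (n : ℕ) : ∀ᵐ y ∂convPow F n, 0 ≤ y := by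
  have hm : Measurable ((Set.Iio (0 : ℝ)).indicator (1 : ℝ → ℝ≥0∞)) :=
    measurable_one.indicator measurableSet_Iio
  have key : ∫⁻ y, (Set.Iio (0 : ℝ)).indicator 1 y ∂convPow F n = 0 := by
    induction n with
    | zero => exact (lintegral_dirac' 0 hm).trans (by simp)
    | succ n ih =>
      rw [lintegral_convPow_succ n hm, ← nonpos_iff_eq_zero, ← ih]
      refine lintegral_mono fun y => ?_
      calc ∫⁻ x, (Set.Iio (0 : ℝ)).indicator 1 (y + x) ∂F
          ≤ ∫⁻ _, (Set.Iio (0 : ℝ)).indicator 1 y ∂F := by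
            refine lintegral_mono_ae ?_
            filter_upwards [hF] with x hx
            simp only [Set.indicator_apply, Set.mem_Iio]
            split_ifs with h1 h2
            · exact le_rfl
            · exact absurd (by linarith) h2
            · exact zero_le
            · exact le_rfl
        _ = _ := by simp
  rw [lintegral_indicator_one measurableSet_Iio] at key
  rw [ae_iff]
  convert key using 2
  ext; simp

lemma ae_nonneg_renewalMeasure (hF : ∀ᵐ x ∂F, 0 ≤ x) : ∀ᵐ y ∂renewalMeasure F, 0 ≤ y := by
  rw [renewalMeasure, Measure.ae_sum_iff]
  exact ae_nonneg_convPow hF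

lemma lintegral_exp_neg_convPow (n : ℕ) :
    ∫⁻ y, ENNReal.ofReal (Real.exp (-y)) ∂convPow F n =
      (∫⁻ x, ENNReal.ofReal (Real.exp (-x)) ∂F) ^ n := by
  have hm : Measurable fun y : ℝ => ENNReal.ofReal (Real.exp (-y)) := by fun_prop
  induction n with
  | zero => exact (lintegral_dirac' 0 hm).trans (by simp)
  | succ n ih =>
    rw [lintegral_convPow_succ n hm, pow_succ, ← ih, ← lintegral_mul_const _ hm]
    refine lintegral_congr fun y => ?_
    rw [← lintegral_const_mul _ hm]
    refine lintegral_congr fun x => ?_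
    rw [neg_add, Real.exp_add, ENNReal.ofReal_mul (Real.exp_pos _).le]

/-- Equality would force `exp (-x) = 1`, hence `x = 0`, almost everywhere, against the nonzero mean.
-/
lemma lintegral_exp_neg_lt_one (hF : ∀ᵐ x ∂F, 0 ≤ x)
    (hF0 : ∫⁻ x, ENNReal.ofReal x ∂F ≠ 0) :
    ∫⁻ x, ENNReal.ofReal (Real.exp (-x)) ∂F < 1 := by
  have hm : Measurable fun y : ℝ => ENNReal.ofReal (Real.exp (-y)) := by fun_prop
  have hle : ∀ᵐ x ∂F, ENNReal.ofReal (Real.exp (-x)) ≤ 1 := by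
    filter_upwards [hF] with x hx
    exact ENNReal.ofReal_le_one.2 (Real.exp_le_one_iff.2 (by linarith))
  have hle1 : ∫⁻ x, ENNReal.ofReal (Real.exp (-x)) ∂F ≤ 1 :=
    (lintegral_mono_ae hle).trans (by simp)
  refine lt_of_le_of_ne hle1 fun h => hF0 ?_
  have hae : (fun x => ENNReal.ofReal (Real.exp (-x))) =ᵐ[F] fun _ => 1 :=
    ae_eq_of_ae_le_of_lintegral_le hle (by simp [h]) aemeasurable_const (by simp [h])
  rw [← lintegral_zero (μ := F)]
  refine lintegral_congr_ae ?_
  filter_upwards [hae] with x hx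
  rw [ENNReal.ofReal_eq_one, Real.exp_eq_one_iff] at hx
  simp [neg_eq_zero.1 hx]

/-- Chernoff bound: the indicator of `y ≤ t` is at most `exp t * exp (-y)`, and the Laplace
transforms at `1` of the convolution powers form a geometric series of ratio below `1`. -/
lemma renewalMeasure_Iic_lt_top (hF : ∀ᵐ x ∂F, 0 ≤ x)
    (hF0 : ∫⁻ x, ENNReal.ofReal x ∂F ≠ 0) (t : ℝ) : renewalMeasure F (Set.Iic t) < ∞ := by
  set q := ∫⁻ x, ENNReal.ofReal (Real.exp (-x)) ∂F with hq
  have hq1 : q < 1 := lintegral_exp_neg_lt_one hF hF0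
  have hn : ∀ n, convPow F n (Set.Iic t) ≤ ENNReal.ofReal (Real.exp t) * q ^ n := by
    intro n
    rw [hq, ← lintegral_exp_neg_convPow, ← lintegral_const_mul _ (by fun_prop),
      ← lintegral_indicator_one measurableSet_Iic]
    refine lintegral_mono fun y => ?_
    refine Set.indicator_apply_le' (fun hy => ?_) fun _ => zero_le
    rw [← ENNReal.ofReal_mul (Real.exp_pos _).le, ← Real.exp_add]
    exact ENNReal.one_le_ofReal.2 (Real.one_le_exp (by simpa using hy))
  calc renewalMeasure F (Set.Iic t) = ∑' n, convPow F n (Set.Iic t) :=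
        renewalMeasure_apply F measurableSet_Iic
    _ ≤ ∑' n, ENNReal.ofReal (Real.exp t) * q ^ n := ENNReal.tsum_le_tsum hn
    _ = ENNReal.ofReal (Real.exp t) * (1 - q)⁻¹ := by
        rw [ENNReal.tsum_mul_left, ENNReal.tsum_geometric]
    _ < ∞ := ENNReal.mul_lt_top ENNReal.ofReal_lt_top
        (ENNReal.inv_lt_top.2 (tsub_pos_of_lt hq1))

/-- Subadditivity of the renewal function. -/
lemma renewalMeasure_Iic_add_le {s : ℝ} (hs : 0 ≤ s) (t : ℝ) :
    renewalMeasure F (Set.Iic (t + s)) ≤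
      renewalMeasure F (Set.Iic t) + renewalMeasure F (Set.Iic s) := by
  have key : ∀ n : ℕ, ∀ t : ℝ, ∑ k ∈ Finset.range n, convPow F k (Set.Iic (t + s)) ≤
      ∑ k ∈ Finset.range n, convPow F k (Set.Iic t) + renewalMeasure F (Set.Iic s) := by
    intro n
    induction n with
    | zero => simp
    | succ n ih =>
      intro t
      rcases lt_or_ge t 0 with ht | ht
      · refine le_add_left ?_
        rw [renewalMeasure_apply F measurableSet_Iic]
        refine (ENNReal.sum_le_tsum _).trans (ENNReal.tsum_le_tsum fun k => ?_)
        exact measure_mono (Set.Iic_subset_Iic.2 (by linarith))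
      · have hmeas : ∀ k, ∀ c : ℝ, Measurable fun x => convPow F k (Set.Iic (c - x)) := by
          intro k c
          have : Antitone fun x => convPow F k (Set.Iic (c - x)) := fun x y hxy =>
            measure_mono (Set.Iic_subset_Iic.2 (by linarith))
          exact this.measurable
        have h0 : ∀ c : ℝ, 0 ≤ c → convPow F 0 (Set.Iic c) = 1 := by
          intro c hc
          change Measure.dirac (0 : ℝ) (Set.Iic c) = 1
          simp [hc]
        rw [Finset.sum_range_succ', Finset.sum_range_succ', h0 _ ht, h0 _ (by linarith)]
        simp_rw [convPow_succ_Iic]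
        rw [← lintegral_finsetSum _ fun k _ => hmeas k _,
          ← lintegral_finsetSum _ fun k _ => hmeas k _, add_right_comm]
        gcongr
        calc ∫⁻ x, ∑ k ∈ Finset.range n, convPow F k (Set.Iic (t + s - x)) ∂F
            ≤ ∫⁻ x, (∑ k ∈ Finset.range n, convPow F k (Set.Iic (t - x)) +
                renewalMeasure F (Set.Iic s)) ∂F := by
              refine lintegral_mono fun x => ?_
              have := ih (t - x)
              rwa [show t - x + s = t + s - x by ring] at this
          _ = _ := by
              rw [lintegral_add_right _ measurable_const]
              simp
  rw [renewalMeasure_apply F (s := Set.Iic (t + s)) measurableSet_Iic]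
  refine ENNReal.tsum_le_of_sum_range_le fun n => (key n t).trans ?_
  gcongr
  rw [renewalMeasure_apply F measurableSet_Iic]
  exact ENNReal.sum_le_tsum _

/-- Partial integration against a renewal measure. -/
lemma lintegral_mul_renewalMeasure_Iic (hF : ∀ᵐ x ∂F, 0 ≤ x) {w : ℝ → ℝ≥0∞}
    (hw : Measurable w) (t : ℝ) :
    ∫⁻ s in Set.Icc 0 t, w s * renewalMeasure F (Set.Iic s) =
      ∫⁻ y, (∫⁻ s in Set.Icc y t, w s) ∂renewalMeasure F := by
  have hset : MeasurableSet {p : ℝ × ℝ | p.2 ≤ p.1} := measurableSet_le measurable_snd measurable_fst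
  calc ∫⁻ s in Set.Icc 0 t, w s * renewalMeasure F (Set.Iic s)
      = ∫⁻ s in Set.Icc 0 t,
          ∫⁻ y, {p : ℝ × ℝ | p.2 ≤ p.1}.indicator (fun p => w p.1) (s, y)
            ∂renewalMeasure F := by
        refine lintegral_congr fun s => ?_
        rw [← lintegral_indicator_const measurableSet_Iic]
        rfl
    _ = ∫⁻ y, (∫⁻ s in Set.Icc 0 t,
          {p : ℝ × ℝ | p.2 ≤ p.1}.indicator (fun p => w p.1) (s, y)) ∂renewalMeasure F :=
        lintegral_lintegral_swap
          ((hw.comp measurable_fst).indicator hset).aemeasurable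
    _ = _ := by
        refine lintegral_congr_ae ?_
        filter_upwards [ae_nonneg_renewalMeasure hF] with y hy
        rw [← lintegral_indicator measurableSet_Icc, ← lintegral_indicator measurableSet_Icc]
        refine lintegral_congr fun s => ?_
        simp only [Set.indicator_apply, Set.mem_Icc, Set.mem_ofPred_eq]
        split_ifs with h1 h2 h3 h3 h3
        · rfl
        · exact absurd ⟨h2, h1.2⟩ h3
        · exact absurd h3.1 h2
        · rfl
        · exact absurd ⟨hy.trans h3.1, h3.2⟩ h1
        · rfl

lemma lintegral_Icc_comp_sub (f : ℝ → ℝ≥0∞) (t : ℝ) :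
    ∫⁻ s in Set.Icc 0 t, f (t - s) = ∫⁻ s in Set.Icc 0 t, f s := by
  rw [← lintegral_indicator measurableSet_Icc, ← lintegral_indicator measurableSet_Icc,
    ← lintegral_sub_left_eq_self _ t]
  refine lintegral_congr fun s => ?_
  simp only [Set.indicator_apply, Set.mem_Icc]
  congr 1
  · simp only [eq_iff_iff, sub_nonneg, sub_le_self_iff]
    exact and_comm
  · rw [sub_sub_cancel]

end Renewal
-- Lorden's inequality and the expected excess
section Lorden

lemma lintegral_ofReal_ne_zero {F : Measure ℝ} (hF : ∀ᵐ x ∂F, 0 ≤ x) (hpos : 0 < ∫ x, x ∂F) :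
    ∫⁻ x, ENNReal.ofReal x ∂F ≠ 0 := by
  intro h
  rw [integral_eq_lintegral_of_nonneg_ae hF measurable_id.aestronglyMeasurable, h] at hpos
  simp at hpos

variable {F : Measure ℝ} [IsProbabilityMeasure F]

/-- The restriction of the renewal equation to a half-line, as an inequality. -/
lemma setLIntegral_renewalMeasure_le (hF : ∀ᵐ x ∂F, 0 ≤ x) {h : ℝ → ℝ≥0∞} (hh : Measurable h)
    (t : ℝ) :
    ∫⁻ y in Set.Iic t, h y ∂renewalMeasure F ≤
      h 0 + ∫⁻ y in Set.Iic t, ∫⁻ x, h (y + x) ∂F ∂renewalMeasure F := by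
  rw [← lintegral_indicator measurableSet_Iic, ← lintegral_indicator measurableSet_Iic,
    lintegral_renewalMeasure_eq_add (hh.indicator measurableSet_Iic)]
  gcongr with y
  · exact Set.indicator_le_self _ _ _
  -- For `y ≤ t` the part with `y + x > t` is added, which is the contribution of the first epoch
  -- beyond `t`; for `y > t` nothing is lost because steps are nonnegative.
  · simp only [Set.indicator_apply, Set.mem_Iic]
    split_ifs with hy
    · refine lintegral_mono fun x => ?_
      split_ifs
      · exact le_rfl
      · exact zero_le
    · refine ((lintegral_congr_ae (g := fun _ => 0) ?_).trans lintegral_zero).le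
      filter_upwards [hF] with x hx
      rw [if_neg]
      linarith

/-- Subadditivity with `t` split into `t - s` and `s`, averaged over `s` in `[0, t]`: the symmetry
`s ↦ t - s` yields twice the integral of the renewal function, which is twice the integral of `(t -
y)⁺` against the renewal measure. -/
lemma two_mul_setIntegral_renewalMeasure_le (hF : ∀ᵐ x ∂F, 0 ≤ x) (hpos : 0 < ∫ x, x ∂F)
    {t : ℝ} (ht : 0 ≤ t) :
    2 * ∫ y in Set.Iic t, y ∂renewalMeasure F ≤ t * (renewalMeasure F).real (Set.Iic t) := by
  have hfin := fun s => renewalMeasure_Iic_lt_top hF (lintegral_ofReal_ne_zero hF hpos) s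
  have hmeas : Measurable fun s => renewalMeasure F (Set.Iic s) :=
    Monotone.measurable fun x y hxy => measure_mono (Set.Iic_subset_Iic.2 hxy)
  have hA : ∫⁻ s in Set.Icc 0 t, renewalMeasure F (Set.Iic s) =
      ∫⁻ y, ENNReal.ofReal (t - y) ∂renewalMeasure F := by
    have := lintegral_mul_renewalMeasure_Iic hF (w := 1) measurable_one t
    simpa using this
  have hsub : ENNReal.ofReal t * renewalMeasure F (Set.Iic t) ≤
      2 * ∫⁻ y, ENNReal.ofReal (t - y) ∂renewalMeasure F := by
    rw [← hA]
    calc ENNReal.ofReal t * renewalMeasure F (Set.Iic t)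
        = ∫⁻ _ in Set.Icc 0 t, renewalMeasure F (Set.Iic t) := by
          simp [mul_comm]
      _ ≤ ∫⁻ s in Set.Icc 0 t,
            (renewalMeasure F (Set.Iic (t - s)) + renewalMeasure F (Set.Iic s)) := by
          refine setLIntegral_mono' measurableSet_Icc fun s hs => ?_
          simpa using renewalMeasure_Iic_add_le (F := F) hs.1 (t - s)
      _ = _ := by
          rw [lintegral_add_right _ hmeas,
            lintegral_Icc_comp_sub (fun s => renewalMeasure F (Set.Iic s)), two_mul]
  have : IsFiniteMeasure ((renewalMeasure F).restrict (Set.Iic t)) :=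
    ⟨by simpa using hfin t⟩
  have hy : ∀ᵐ y ∂(renewalMeasure F).restrict (Set.Iic t), 0 ≤ y ∧ y ≤ t := by
    filter_upwards [ae_restrict_of_ae (ae_nonneg_renewalMeasure hF),
      ae_restrict_mem measurableSet_Iic] with y h1 h2 using ⟨h1, h2⟩
  have hint : Integrable (fun y : ℝ => y) ((renewalMeasure F).restrict (Set.Iic t)) := by
    refine Integrable.of_bound measurable_id.aestronglyMeasurable t ?_
    filter_upwards [hy] with y hy
    rw [Real.norm_of_nonneg hy.1]
    exact hy.2
  have hsubint : Integrable (fun y : ℝ => t - y) ((renewalMeasure F).restrict (Set.Iic t)) :=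
    (integrable_const t).sub hint
  have hB : ∫⁻ y, ENNReal.ofReal (t - y) ∂renewalMeasure F =
      ENNReal.ofReal (∫ y in Set.Iic t, (t - y) ∂renewalMeasure F) := by
    rw [ofReal_integral_eq_lintegral_ofReal hsubint
      (by filter_upwards [hy] with y hy using sub_nonneg.2 hy.2),
      ← lintegral_indicator measurableSet_Iic]
    refine lintegral_congr fun y => ?_
    rw [Set.indicator_apply]
    split_ifs with h
    · rfl
    · exact ENNReal.ofReal_of_nonpos (sub_nonpos.2 (not_le.1 h).le)
  rw [hB, integral_sub (integrable_const t) hint] at hsub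
  have h0 : 0 ≤ (∫ _ in Set.Iic t, t ∂renewalMeasure F) - ∫ y in Set.Iic t, y ∂renewalMeasure F := by
    rw [← integral_sub (integrable_const t) hint]
    exact integral_nonneg_of_ae (by filter_upwards [hy] with y hy using sub_nonneg.2 hy.2)
  have hsub' := ENNReal.toReal_mono (by finiteness) hsub
  rw [ENNReal.toReal_mul, ENNReal.toReal_mul, ENNReal.toReal_ofReal ht,
    ENNReal.toReal_ofReal h0, integral_const] at hsub'
  simp only [measureReal_restrict_apply_univ, smul_eq_mul, ENNReal.toReal_ofNat] at hsub'
  change t * (renewalMeasure F).real (Set.Iic t) ≤ _ at hsub'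
  linarith

/-- Lorden's inequality for the renewal function. -/
theorem renewalMeasure_Iic_le (hF : ∀ᵐ x ∂F, 0 ≤ x) (hpos : 0 < ∫ x, x ∂F)
    (hsq : Integrable (fun x => x ^ 2) F) {t : ℝ} (ht : 0 ≤ t) :
    renewalMeasure F (Set.Iic t) ≤
      ENNReal.ofReal (t / (∫ x, x ∂F) + (∫ x, x ^ 2 ∂F) / (∫ x, x ∂F) ^ 2) := by
  have hY := two_mul_setIntegral_renewalMeasure_le hF hpos ht
  have hfin := renewalMeasure_Iic_lt_top hF (lintegral_ofReal_ne_zero hF hpos) t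
  have hid : Integrable (fun x : ℝ => x) F :=
    ((memLp_two_iff_integrable_sq measurable_id.aestronglyMeasurable).2 hsq).integrable one_le_two
  set μ := ∫ x, x ∂F with hμ
  set μ₂ := ∫ x, x ^ 2 ∂F with hμ₂
  set U := (renewalMeasure F).real (Set.Iic t) with hU
  set Y := ∫ y in Set.Iic t, y ∂renewalMeasure F with hYdef
  -- By Wald's identity `m` is the mean of the first epoch beyond `t`. Centring the square there
  -- makes the term dropped from the renewal equation the variance of that epoch.
  set m := μ * U with hm
  have : IsFiniteMeasure ((renewalMeasure F).restrict (Set.Iic t)) :=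
    ⟨by simpa using hfin⟩
  have hbdd : ∀ g : ℝ → ℝ, Continuous g →
      Integrable g ((renewalMeasure F).restrict (Set.Iic t)) := by
    intro g hg
    obtain ⟨C, hC⟩ := (isCompact_Icc (a := (0 : ℝ)) (b := t)).exists_bound_of_continuousOn
      hg.continuousOn
    refine Integrable.of_bound hg.aestronglyMeasurable C ?_
    filter_upwards [ae_restrict_of_ae (ae_nonneg_renewalMeasure hF),
      ae_restrict_mem measurableSet_Iic] with y h1 h2 using hC y ⟨h1, h2⟩
  have hshift : ∀ y, (∫ x, (y + x - m) ^ 2 ∂F) = (y - m) ^ 2 + (2 * μ * (y - m) + μ₂) ∧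
      Integrable (fun x => (y + x - m) ^ 2) F := by
    intro y
    have he : (fun x : ℝ => (y + x - m) ^ 2) =
        fun x => (y - m) ^ 2 + (2 * (y - m) * x + x ^ 2) := by ext; ring
    have h1 : Integrable (fun x : ℝ => 2 * (y - m) * x) F := hid.const_mul _
    have h2 : Integrable (fun x : ℝ => 2 * (y - m) * x + x ^ 2) F := h1.add hsq
    rw [he]
    refine ⟨?_, (integrable_const _).add h2⟩
    rw [integral_add (integrable_const _) h2, integral_add h1 hsq,
      integral_const_mul]
    simp only [integral_const, probReal_univ, one_smul]
    rw [← hμ, ← hμ₂]; ring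
  have hineq := setLIntegral_renewalMeasure_le hF
    (h := fun y => ENNReal.ofReal ((y - m) ^ 2)) (by fun_prop) t
  have hinner : ∀ y, ∫⁻ x, ENNReal.ofReal ((y + x - m) ^ 2) ∂F =
      ENNReal.ofReal ((y - m) ^ 2 + (2 * μ * (y - m) + μ₂)) := by
    intro y
    rw [← ofReal_integral_eq_lintegral_ofReal (hshift y).2
      (Filter.Eventually.of_forall fun x => sq_nonneg _), (hshift y).1]
  simp_rw [hinner] at hineq
  have hnn : ∀ y, 0 ≤ (y - m) ^ 2 + (2 * μ * (y - m) + μ₂) := fun y => by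
    rw [← (hshift y).1]; exact integral_nonneg fun x => sq_nonneg _
  have hi1 := hbdd (fun y => (y - m) ^ 2) (by fun_prop)
  have hi12 := hbdd (fun y => (y - m) ^ 2 + (2 * μ * (y - m) + μ₂)) (by fun_prop)
  have hi2 := hbdd (fun y => 2 * μ * (y - m) + μ₂) (by fun_prop)
  rw [← ofReal_integral_eq_lintegral_ofReal hi1 (Filter.Eventually.of_forall fun x => sq_nonneg _),
    ← ofReal_integral_eq_lintegral_ofReal hi12 (Filter.Eventually.of_forall hnn),
    ← ENNReal.ofReal_add (sq_nonneg _) (integral_nonneg hnn),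
    ENNReal.ofReal_le_ofReal_iff (add_nonneg (sq_nonneg _) (integral_nonneg hnn)),
    integral_add hi1 hi2] at hineq
  have hlin : ∫ y in Set.Iic t, (2 * μ * (y - m) + μ₂) ∂renewalMeasure F =
      2 * μ * (Y - m * U) + μ₂ * U := by
    have he : (fun y : ℝ => 2 * μ * (y - m) + μ₂) = fun y => 2 * μ * y + (μ₂ - 2 * μ * m) := by
      ext; ring
    rw [he, integral_add (hbdd _ (by fun_prop)) (integrable_const _), integral_const_mul,
      integral_const]
    simp only [measureReal_restrict_apply_univ, smul_eq_mul]
    rw [← hYdef, ← hU]; ring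
  rw [hlin] at hineq
  have hμ₂0 : 0 ≤ μ₂ := integral_nonneg fun x => sq_nonneg _
  have hU0 : 0 ≤ U := measureReal_nonneg
  -- After cancelling the common integral of `(y - m) ^ 2`, `hineq` reads `m ^ 2 ≤ 2 * μ * Y + μ₂ *
  -- U`; then `2 * Y ≤ t * U` is inserted.
  have hmain : U * (μ ^ 2 * U) ≤ U * (μ * t + μ₂) := by
    have := mul_le_mul_of_nonneg_left hY hpos.le
    rw [hm] at hineq
    nlinarith
  have hfinal : U ≤ t / μ + μ₂ / μ ^ 2 := by
    rcases hU0.eq_or_lt with h0 | h0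
    · rw [← h0]; positivity
    · have h1 := le_of_mul_le_mul_left hmain h0
      have h2 : t / μ + μ₂ / μ ^ 2 = (μ * t + μ₂) / μ ^ 2 := by field_simp
      rw [h2, le_div_iff₀ (by positivity)]
      linarith
  rw [← ENNReal.ofReal_toReal hfin.ne]
  exact ENNReal.ofReal_le_ofReal hfinal

/-- Writes the excess as an integral over levels `s`, so that partial integration brings in the
renewal function. -/
lemma lintegral_Icc_exp_sub (y τ : ℝ) :
    ENNReal.ofReal (1 - Real.exp (y - τ)) ≤
      ∫⁻ s in Set.Icc y τ, ENNReal.ofReal (Real.exp (s - τ)) := by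
  rcases lt_or_ge τ y with h | h
  · rw [ENNReal.ofReal_of_nonpos]
    · exact zero_le
    · linarith [Real.one_le_exp (show 0 ≤ y - τ by linarith)]
  · have hc : Continuous fun s => Real.exp (s - τ) := by fun_prop
    rw [← ofReal_integral_eq_lintegral_ofReal
      (hc.integrableOn_Icc) (Filter.Eventually.of_forall fun x => (Real.exp_pos _).le),
      integral_Icc_eq_integral_Ioc, ← intervalIntegral.integral_of_le h,
      intervalIntegral.integral_comp_sub_right (fun s => Real.exp s), integral_exp]
    simp

lemma integral_exp_sub_mul_linear (τ c k : ℝ) :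
    ∫ s in (0 : ℝ)..τ, Real.exp (s - τ) * (s * c + k) =
      (τ - 1 + Real.exp (-τ)) * c + k * (1 - Real.exp (-τ)) := by
  have hd : ∀ s ∈ Set.uIcc 0 τ, HasDerivAt (fun s => Real.exp (s - τ) * ((s - 1) * c + k))
      (Real.exp (s - τ) * (s * c + k)) s := by
    intro s _
    have h1 : HasDerivAt (fun s => Real.exp (s - τ)) (Real.exp (s - τ) * 1) s :=
      ((hasDerivAt_id s).sub_const τ).exp
    have h2 : HasDerivAt (fun s : ℝ => (s - 1) * c + k) (1 * c) s :=
      (((hasDerivAt_id s).sub_const 1).mul_const c).add_const k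
    exact (h1.mul h2).congr_deriv (by ring)
  rw [intervalIntegral.integral_eq_sub_of_hasDerivAt hd
    (Continuous.intervalIntegrable (by fun_prop) _ _)]
  simp only [sub_self, Real.exp_zero, zero_sub]
  ring

/-- The expected total excess over the level `exp (-τ)`. -/
lemma lintegral_excess_renewalMeasure_le (hF : ∀ᵐ x ∂F, 0 ≤ x) (hpos : 0 < ∫ x, x ∂F)
    (hsq : Integrable (fun x => x ^ 2) F) {τ : ℝ} (hτ : 0 ≤ τ) :
    ∫⁻ y, ENNReal.ofReal (1 - Real.exp (y - τ)) ∂renewalMeasure F ≤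
      ENNReal.ofReal ((τ - 1 + Real.exp (-τ)) * (1 / ∫ x, x ∂F) +
        (∫ x, x ^ 2 ∂F) / (∫ x, x ∂F) ^ 2 * (1 - Real.exp (-τ))) := by
  rw [← integral_exp_sub_mul_linear, intervalIntegral.integral_of_le hτ,
    ← integral_Icc_eq_integral_Ioc]
  have hc : Continuous fun s => Real.exp (s - τ) *
      (s * (1 / ∫ x, x ∂F) + (∫ x, x ^ 2 ∂F) / (∫ x, x ∂F) ^ 2) := by fun_prop
  have h2 : 0 ≤ ∫ x, x ^ 2 ∂F := integral_nonneg fun x => sq_nonneg _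
  rw [ofReal_integral_eq_lintegral_ofReal hc.integrableOn_Icc]
  · calc ∫⁻ y, ENNReal.ofReal (1 - Real.exp (y - τ)) ∂renewalMeasure F
        ≤ ∫⁻ y, (∫⁻ s in Set.Icc y τ, ENNReal.ofReal (Real.exp (s - τ))) ∂renewalMeasure F :=
          lintegral_mono fun y => lintegral_Icc_exp_sub y τ
      _ = ∫⁻ s in Set.Icc 0 τ,
            ENNReal.ofReal (Real.exp (s - τ)) * renewalMeasure F (Set.Iic s) :=
          (lintegral_mul_renewalMeasure_Iic hF (by fun_prop) τ).symm
      _ ≤ _ := by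
          refine setLIntegral_mono' measurableSet_Icc fun s hs => ?_
          rw [ENNReal.ofReal_mul (Real.exp_pos _).le, mul_one_div]
          gcongr
          exact renewalMeasure_Iic_le hF hpos hsq hs.1
  · filter_upwards [ae_restrict_mem measurableSet_Icc] with s hs
    have := hs.1
    positivity

end Lorden

/-! ### Acceptance probabilities on a fixed token tree -/

section Tree
variable {V : Type*}

lemma genTokens_succ_append (u : TokenTree V) (n : ℕ) (s : List V) (v : V) :
    genTokens u (n + 1) (s ++ [v]) = genTokens u n s * u s v := by
  classical
  rw [genTokens, PMF.bind_apply, tsum_eq_single s]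
  · rw [PMF.map_apply, tsum_eq_single v]
    · simp
    · intro w hw
      simp [hw.symm]
  · intro t ht
    rw [PMF.map_apply, ENNReal.tsum_eq_zero.2, mul_zero]
    intro w
    rw [if_neg]
    intro h
    exact ht (List.append_inj_left' h rfl).symm

lemma tsum_genTokens_succ_mul (u : TokenTree V) (n : ℕ) (g : List V → ℝ≥0∞) :
    ∑' s, genTokens u (n + 1) s * g s =
      ∑' s, ∑' v, genTokens u n s * u s v * g (s ++ [v]) := by
  classical
  have hmap : ∀ s t, ((u s).map fun v => s ++ [v]) t * g t =
      ∑' v, (if t = s ++ [v] then u s v * g (s ++ [v]) else 0) := by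
    intro s t
    rw [PMF.map_apply, ← ENNReal.tsum_mul_right]
    refine tsum_congr fun v => ?_
    split_ifs with h
    · rw [h]
    · simp
  have hs : ∀ s, ∑' t, ((u s).map fun v => s ++ [v]) t * g t = ∑' v, u s v * g (s ++ [v]) := by
    intro s
    simp_rw [hmap]
    rw [ENNReal.tsum_comm]
    exact tsum_congr fun v => tsum_ite_eq _ _
  calc ∑' t, genTokens u (n + 1) t * g t
      = ∑' t, ∑' s, genTokens u n s * (((u s).map fun v => s ++ [v]) t * g t) := by
        refine tsum_congr fun t => ?_
        rw [genTokens, PMF.bind_apply, ← ENNReal.tsum_mul_right]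
        exact tsum_congr fun s => mul_assoc _ _ _
    _ = ∑' s, genTokens u n s * ∑' v, u s v * g (s ++ [v]) := by
        rw [ENNReal.tsum_comm]
        refine tsum_congr fun s => ?_
        rw [ENNReal.tsum_mul_left, hs]
    _ = _ := by
        refine tsum_congr fun s => ?_
        rw [← ENNReal.tsum_mul_left]
        exact tsum_congr fun v => (mul_assoc _ _ _).symm

lemma genTokens_eq_zero (u : TokenTree V) :
    ∀ (n : ℕ) (s : List V), s.length ≠ n → genTokens u n s = 0 := by
  intro n
  induction n with
  | zero =>
    intro s hs
    rw [genTokens, PMF.pure_apply, if_neg]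
    rintro rfl
    exact hs rfl
  | succ n ih =>
    intro s hs
    rcases List.eq_nil_or_concat' s with rfl | ⟨t, v, rfl⟩
    · rw [genTokens, PMF.bind_apply, ENNReal.tsum_eq_zero.2]
      intro t
      rw [PMF.map_apply, ENNReal.tsum_eq_zero.2, mul_zero]
      intro w
      simp
    · rw [genTokens_succ_append, ih t (by simpa using hs), zero_mul]

/-- The probability that the node `s` is accepted. -/
noncomputable def nodeProb (u : TokenTree V) (s : List V) : ℝ≥0∞ := genTokens u s.length s

lemma nodeProb_nil (u : TokenTree V) : nodeProb u [] = 1 := by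
  simp [nodeProb, genTokens]

lemma nodeProb_le_one (u : TokenTree V) (s : List V) : nodeProb u s ≤ 1 :=
  PMF.coe_le_one _ _

lemma tsum_nodeProb_mul (u : TokenTree V) (g : List V → ℝ≥0∞) :
    ∑' s, nodeProb u s * g s = ∑' n, ∑' s, genTokens u n s * g s := by
  rw [ENNReal.tsum_comm]
  refine tsum_congr fun s => ?_
  rw [tsum_eq_single s.length]
  · rfl
  · intro n hn
    rw [genTokens_eq_zero u n s hn.symm, zero_mul]

open Classical in
/-- A node is accepted with probability at most `nodeProb`. -/
lemma tsum_genTokens_prefix_le (u : TokenTree V) (x : List V) (n : ℕ) :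
    ∑' s, genTokens u n s * (if x <+: s then 1 else 0) ≤ nodeProb u x := by
  induction n with
  | zero =>
    rw [tsum_eq_single []]
    · rcases x with _ | ⟨v, x⟩
      · simp [nodeProb_nil, genTokens]
      · simp
    · intro s hs
      rw [genTokens_eq_zero u 0 s (by simpa using hs), zero_mul]
  | succ n ih =>
    -- If `x` has more than `n` nodes below the root on its path, only `s = x` can have it as a
    -- prefix. Otherwise the last token does not affect the prefix relation and its probabilities
    -- sum to `1`.
    rcases Nat.lt_or_ge n x.length with hx | hx
    · rw [tsum_eq_single x]
      · simp only [List.prefix_rfl, if_true, mul_one]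
        by_cases hl : x.length = n + 1
        · rw [nodeProb, hl]
        · rw [genTokens_eq_zero u (n + 1) x hl]
          exact zero_le
      · intro s hs
        by_cases hl : s.length = n + 1
        · rw [if_neg, mul_zero]
          intro h
          exact hs (h.eq_of_length_le (by omega)).symm
        · rw [genTokens_eq_zero u (n + 1) s hl, zero_mul]
    · refine le_trans (le_of_eq ?_) ih
      rw [tsum_genTokens_succ_mul]
      refine tsum_congr fun s => ?_
      by_cases hl : s.length = n
      · have : ∀ v, (x <+: s ++ [v]) ↔ x <+: s := by
          intro v
          rw [List.prefix_concat_iff]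
          refine or_iff_right ?_
          rintro rfl
          simp at hx
          omega
        simp_rw [this]
        rw [ENNReal.tsum_mul_right, ENNReal.tsum_mul_left, PMF.tsum_coe, mul_one]
      · simp [genTokens_eq_zero u n s hl]

open Classical in
-- All `x.length + 1` prefixes of an accepted node `x` are distinct, accepted, and in `D` by closure
-- under parents.
lemma acceptedLength_le_card {P : ℕ} {D : Finset (List V)} (hD : IsDraftTree P D)
    (s : List V) : acceptedLength D s ≤ (D.filter fun x => x <+: s).card := by
  have hpre : ∀ x y : List V, x ++ y ∈ D → x ∈ D := by
    intro x y
    induction y using List.reverseRecOn with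
    | nil => simp
    | append_singleton y v ih =>
      intro h
      exact ih (hD.parent_mem _ v (by simpa using h))
  refine Finset.sup_le fun x hx => ?_
  rw [Finset.mem_filter] at hx
  calc x.length + 1 = (x.inits.toFinset).card := by
        rw [List.toFinset_card_of_nodup, List.length_inits]
        exact List.nodup_iff_injective_get.2 fun i j hij => by
          have := congrArg List.length hij
          simp at this
          have hi := i.2
          have hj := j.2
          simp only [List.length_inits] at hi hj
          ext
          omega
    _ ≤ _ := by
        refine Finset.card_le_card fun y hy => ?_
        rw [List.mem_toFinset, List.mem_inits] at hy
        rw [Finset.mem_filter]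
        refine ⟨?_, hy.trans hx.2⟩
        obtain ⟨z, rfl⟩ := hy
        exact hpre y z hx.1

lemma verifExpectation_le_sum_nodeProb {P : ℕ} {D : Finset (List V)} (hD : IsDraftTree P D)
    (u : TokenTree V) : verifExpectation P u D ≤ ∑ x ∈ D, nodeProb u x := by
  classical
  calc verifExpectation P u D
      ≤ ∑' s, ∑ x ∈ D, genTokens u P s * (if x <+: s then 1 else 0) := by
        refine ENNReal.tsum_le_tsum fun s => ?_
        rw [← Finset.mul_sum, Finset.sum_boole]
        gcongr
        refine (acceptedLength_le_card hD s).trans (le_of_eq ?_)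
        congr!
    _ = ∑ x ∈ D, ∑' s, genTokens u P s * (if x <+: s then 1 else 0) :=
        Summable.tsum_finsetSum fun _ _ => ENNReal.summable
    _ ≤ ∑ x ∈ D, nodeProb u x := by
        refine Finset.sum_le_sum fun x _ => ?_
        convert tsum_genTokens_prefix_le u x P

/-- The surprisal `-log p` of a probability. -/
noncomputable def surprisal (p : ℝ≥0∞) : ℝ := -Real.log p.toReal

lemma measurable_surprisal : Measurable surprisal := by
  unfold surprisal; fun_prop

lemma surprisal_mul {p q : ℝ≥0∞} (hp : p ≠ 0) (hp' : p ≠ ∞) (hq : q ≠ 0) (hq' : q ≠ ∞) :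
    surprisal (p * q) = surprisal p + surprisal q := by
  rw [surprisal, ENNReal.toReal_mul, Real.log_mul (ENNReal.toReal_ne_zero.2 ⟨hp, hp'⟩)
    (ENNReal.toReal_ne_zero.2 ⟨hq, hq'⟩), surprisal, surprisal, neg_add]

lemma surprisal_nonneg {p : ℝ≥0∞} (hp : p ≤ 1) : 0 ≤ surprisal p :=
  neg_nonneg.2 (Real.log_nonpos ENNReal.toReal_nonneg
    (ENNReal.toReal_le_of_le_ofReal zero_le_one (by simpa using hp)))

/-- The gain of a node over the threshold `exp (-τ)`, relative to its probability. -/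
noncomputable def excess (τ y : ℝ) : ℝ≥0∞ := ENNReal.ofReal (1 - Real.exp (y - τ))

lemma measurable_excess (τ : ℝ) : Measurable (excess τ) := by
  unfold excess; fun_prop

/-- For `p ≠ 0`, `exp (surprisal p - τ) = exp (-τ) / p`, so `p * excess τ (surprisal p)` is the
positive part of `p - exp (-τ)`. -/
lemma le_mul_excess_add {p : ℝ≥0∞} (hp : p ≤ 1) (τ : ℝ) :
    p ≤ p * excess τ (surprisal p) + ENNReal.ofReal (Real.exp (-τ)) := by
  rcases eq_or_ne p 0 with rfl | h0
  · exact zero_le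
  have htop : p ≠ ∞ := ne_top_of_le_ne_top ENNReal.one_ne_top hp
  have hpos : 0 < p.toReal := ENNReal.toReal_pos h0 htop
  have hexp : Real.exp (surprisal p - τ) = Real.exp (-τ) / p.toReal := by
    rw [surprisal, sub_eq_add_neg, Real.exp_add, Real.exp_neg, Real.exp_log hpos]
    field_simp
  rw [excess, hexp]
  nth_rewrite 1 2 [← ENNReal.ofReal_toReal htop]
  rw [← ENNReal.ofReal_mul hpos.le, mul_sub, mul_one, mul_div_cancel₀ _ hpos.ne']
  calc ENNReal.ofReal p.toReal = ENNReal.ofReal (p.toReal - Real.exp (-τ) + Real.exp (-τ)) := by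
        rw [sub_add_cancel]
    _ ≤ _ := ENNReal.ofReal_add_le

/-- The right-hand side no longer involves `D`: the excess is summed over all nodes, and only the
size bound `P` survives. -/
lemma verifExpectation_le {P : ℕ} {D : Finset (List V)} (hD : IsDraftTree P D)
    (u : TokenTree V) (τ : ℝ) : verifExpectation P u D ≤
      ∑' s, nodeProb u s * excess τ (surprisal (nodeProb u s)) +
        ENNReal.ofReal (P * Real.exp (-τ)) := by
  calc verifExpectation P u D ≤ ∑ x ∈ D, nodeProb u x := verifExpectation_le_sum_nodeProb hD u
    _ ≤ ∑ x ∈ D, (nodeProb u x * excess τ (surprisal (nodeProb u x)) +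
          ENNReal.ofReal (Real.exp (-τ))) :=
        Finset.sum_le_sum fun x _ => le_mul_excess_add (nodeProb_le_one u x) τ
    _ ≤ _ := by
        rw [Finset.sum_add_distrib]
        gcongr
        · exact ENNReal.sum_le_tsum _
        · rw [Finset.sum_const, nsmul_eq_mul, ENNReal.ofReal_mul (Nat.cast_nonneg _),
            ENNReal.ofReal_natCast]
          gcongr
          exact hD.card_le

end Tree
-- From the random token tree to the renewal process
section RandomTree

variable {V Ω : Type*} [MeasurableSpace Ω] {Pr : Measure Ω} {β : Ω → TokenTree V}

/-- The law of the surprisal of a token drawn from the next-token distribution. -/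
noncomputable def stepLaw (Pr : Measure Ω) (β : Ω → TokenTree V) : Measure ℝ :=
  Measure.sum fun v => (Pr.withDensity fun ω => β ω [] v).map fun ω => surprisal (β ω [] v)

namespace IsIIDTokenTree

lemma measurable_apply (hβ : IsIIDTokenTree Pr β) (s : List V) (v : V) :
    Measurable fun ω => β ω s v :=
  (measurable_pi_apply v).comp (hβ.measurable s)

lemma measurable_genTokens (hβ : IsIIDTokenTree Pr β) (n : ℕ) (s : List V) :
    Measurable fun ω => genTokens (β ω) n s := by
  induction n generalizing s with
  | zero => exact measurable_const
  | succ n ih =>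
    rcases List.eq_nil_or_concat' s with rfl | ⟨t, v, rfl⟩
    · simp_rw [genTokens_eq_zero _ (n + 1) [] (by simp)]
      exact measurable_const
    · simp_rw [genTokens_succ_append]
      exact (ih t).mul (hβ.measurable_apply t v)

lemma lintegral_stepLaw (hβ : IsIIDTokenTree Pr β) {f : ℝ → ℝ≥0∞} (hf : Measurable f) :
    ∫⁻ x, f x ∂stepLaw Pr β = ∑' v, ∫⁻ ω, β ω [] v * f (surprisal (β ω [] v)) ∂Pr := by
  rw [stepLaw, lintegral_sum_measure]
  refine tsum_congr fun v => ?_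
  have hm : Measurable fun ω => surprisal (β ω [] v) :=
    measurable_surprisal.comp (hβ.measurable_apply [] v)
  rw [lintegral_map hf hm]
  exact lintegral_withDensity_eq_lintegral_mul _ (hβ.measurable_apply [] v) (hf.comp hm)

lemma lintegral_stepLaw_eq [Countable V] (hβ : IsIIDTokenTree Pr β) {f : ℝ → ℝ≥0∞}
    (hf : Measurable f) :
    ∫⁻ x, f x ∂stepLaw Pr β = ∫⁻ ω, ∑' v, β ω [] v * f (surprisal (β ω [] v)) ∂Pr := by
  rw [hβ.lintegral_stepLaw hf, lintegral_tsum]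
  exact fun v => ((hβ.measurable_apply [] v).mul
    (hf.comp (measurable_surprisal.comp (hβ.measurable_apply [] v)))).aemeasurable

lemma isProbabilityMeasure_stepLaw [Countable V] [IsProbabilityMeasure Pr]
    (hβ : IsIIDTokenTree Pr β) : IsProbabilityMeasure (stepLaw Pr β) := by
  constructor
  rw [← lintegral_one, hβ.lintegral_stepLaw_eq measurable_const]
  simp [PMF.tsum_coe]

lemma ae_nonneg_stepLaw [Countable V] (hβ : IsIIDTokenTree Pr β) :
    ∀ᵐ x ∂stepLaw Pr β, 0 ≤ x := by
  have h : ∫⁻ x, (Set.Iio (0 : ℝ)).indicator 1 x ∂stepLaw Pr β = 0 := by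
    rw [hβ.lintegral_stepLaw_eq (measurable_one.indicator measurableSet_Iio)]
    have : ∀ ω v, β ω [] v * (Set.Iio (0 : ℝ)).indicator 1 (surprisal (β ω [] v)) = 0 := by
      intro ω v
      rw [Set.indicator_of_notMem, mul_zero]
      simpa using surprisal_nonneg ((β ω []).coe_le_one v)
    simp [this]
  rw [lintegral_indicator_one measurableSet_Iio] at h
  rw [ae_iff]
  convert h using 2
  ext; simp

lemma lintegral_ofReal_stepLaw [Countable V] (hβ : IsIIDTokenTree Pr β) :
    ∫⁻ x, ENNReal.ofReal x ∂stepLaw Pr β = expectedEntropy Pr β := by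
  rw [hβ.lintegral_stepLaw_eq ENNReal.measurable_ofReal, expectedEntropy]
  refine lintegral_congr fun ω => tsum_congr fun v => ?_
  nth_rewrite 1 [← ENNReal.ofReal_toReal ((β ω []).apply_ne_top v)]
  rw [← ENNReal.ofReal_mul ENNReal.toReal_nonneg, surprisal, Real.negMulLog]
  ring_nf

lemma lintegral_ofReal_sq_stepLaw [Countable V] (hβ : IsIIDTokenTree Pr β) :
    ∫⁻ x, ENNReal.ofReal (x ^ 2) ∂stepLaw Pr β = expectedSecondLogMoment Pr β := by
  rw [hβ.lintegral_stepLaw_eq (by fun_prop), expectedSecondLogMoment]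
  refine lintegral_congr fun ω => tsum_congr fun v => ?_
  nth_rewrite 1 [← ENNReal.ofReal_toReal ((β ω []).apply_ne_top v)]
  rw [← ENNReal.ofReal_mul ENNReal.toReal_nonneg, surprisal]
  ring_nf

/-- The probability of a node is independent of the next-token distribution after it. -/
lemma indepFun_genTokens (hβ : IsIIDTokenTree Pr β) (s : List V) (v : V) :
    IndepFun (fun ω => genTokens (β ω) s.length s) (fun ω => β ω s v) Pr := by
  let m : List V → MeasurableSpace Ω := fun t =>
    MeasurableSpace.comap (fun ω => (⇑(β ω t) : V → ℝ≥0∞)) inferInstance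
  -- Node probabilities at depth `n` depend only on the distributions at depths below `n`. For lists
  -- of another length `genTokens` is constantly zero, so the claim holds for every `t`.
  have hm : ∀ n (t : List V), Measurable[⨆ r ∈ {r : List V | r.length < n}, m r]
      fun ω => genTokens (β ω) n t := by
    intro n
    induction n with
    | zero => exact fun t => measurable_const
    | succ n ih =>
      intro t
      rcases List.eq_nil_or_concat' t with rfl | ⟨t, w, rfl⟩
      · simp_rw [genTokens_eq_zero _ (n + 1) [] (by simp)]
        exact measurable_const
      · simp_rw [genTokens_succ_append]
        by_cases hl : t.length = n
        · refine Measurable.mul ((ih t).mono ?_ le_rfl) ?_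
          · exact biSup_mono fun r (hr : r.length < n) => Nat.lt_succ_of_lt hr
          · have h1 : Measurable[m t] fun ω => β ω t w :=
              (measurable_pi_apply w).comp (comap_measurable _)
            exact h1.mono (le_biSup m (show t.length < n + 1 by omega)) le_rfl
        · simp_rw [genTokens_eq_zero _ n t hl, zero_mul]
          exact measurable_const
  have hind := indep_iSup_of_disjoint (m := m) (μ := Pr) (fun t => (hβ.measurable t).comap_le)
    hβ.indep (S := {r | r.length < s.length}) (T := {s}) (by simp)
  refine indep_of_indep_of_le_left (indep_of_indep_of_le_right hind ?_) ?_
  · refine Measurable.comap_le (m₂ := _) ?_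
    have h1 : Measurable[m s] fun ω => β ω s v :=
      (measurable_pi_apply v).comp (comap_measurable _)
    exact h1.mono (le_biSup m (Set.mem_singleton s)) le_rfl
  · exact Measurable.comap_le (hm s.length s)

/-- By independence and identical distribution, the next-token probability after `s` may be replaced
by that of an independent copy of the root. -/
lemma lintegral_genTokens_apply [IsProbabilityMeasure Pr] (hβ : IsIIDTokenTree Pr β) (n : ℕ)
    (s : List V) (v : V) {f : ℝ → ℝ≥0∞} (hf : Measurable f) :
    ∫⁻ ω, genTokens (β ω) n s * β ω s v *
        f (surprisal (genTokens (β ω) n s * β ω s v)) ∂Pr =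
      ∫⁻ ω, genTokens (β ω) n s * ∫⁻ ω', β ω' [] v *
        f (surprisal (genTokens (β ω) n s) + surprisal (β ω' [] v)) ∂Pr ∂Pr := by
  by_cases hl : s.length = n
  swap
  · simp [genTokens_eq_zero _ n s hl]
  subst hl
  have hX := hβ.measurable_genTokens s.length s
  have hY := hβ.measurable_apply s v
  have hY' := hβ.measurable_apply [] v
  have hΦ : Measurable fun p : ℝ≥0∞ × ℝ≥0∞ =>
      p.1 * (p.2 * f (surprisal p.1 + surprisal p.2)) := by
    have := measurable_surprisal
    fun_prop
  have hlaw : Pr.map (fun ω => β ω s v) = Pr.map (fun ω => β ω [] v) :=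
    ((hβ.identDistrib s).comp (measurable_pi_apply v)).map_eq
  have hmap := (indepFun_iff_map_prod_eq_prod_map_map hX.aemeasurable hY.aemeasurable).1
    (hβ.indepFun_genTokens s v)
  calc ∫⁻ ω, genTokens (β ω) s.length s * β ω s v *
        f (surprisal (genTokens (β ω) s.length s * β ω s v)) ∂Pr
      = ∫⁻ ω, genTokens (β ω) s.length s * (β ω s v *
          f (surprisal (genTokens (β ω) s.length s) + surprisal (β ω s v))) ∂Pr := by
        refine lintegral_congr fun ω => ?_
        rw [mul_assoc]
        -- Surprisal has the default value `0` at probability `0`, where additivity fails; there the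
        -- weight vanishes.
        by_cases h1 : genTokens (β ω) s.length s = 0
        · simp [h1]
        by_cases h2 : β ω s v = 0
        · simp [h2]
        rw [surprisal_mul h1 (PMF.apply_ne_top _ _) h2 (PMF.apply_ne_top _ _)]
    _ = ∫⁻ p, p.1 * (p.2 * f (surprisal p.1 + surprisal p.2))
          ∂(Pr.map fun ω => (genTokens (β ω) s.length s, β ω s v)) :=
        (lintegral_map hΦ (hX.prodMk hY)).symm
    _ = ∫⁻ ω, ∫⁻ ω', genTokens (β ω) s.length s * (β ω' [] v *
          f (surprisal (genTokens (β ω) s.length s) + surprisal (β ω' [] v))) ∂Pr ∂Pr := by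
        have : IsProbabilityMeasure (Pr.map fun ω => β ω [] v) :=
          Measure.isProbabilityMeasure_map hY'.aemeasurable
        rw [hmap, hlaw, lintegral_prod _ hΦ.aemeasurable,
          lintegral_map (hΦ.lintegral_prod_right') hX]
        refine lintegral_congr fun ω => ?_
        exact lintegral_map (hΦ.comp measurable_prodMk_left) hY'
    _ = _ := by
        refine lintegral_congr fun ω => ?_
        rw [lintegral_const_mul']
        exact PMF.apply_ne_top _ _

/-- The surprisal of the first `n` generated tokens is the `n`-th epoch of a renewal process. -/
lemma lintegral_tsum_genTokens [Countable V] [IsProbabilityMeasure Pr]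
    (hβ : IsIIDTokenTree Pr β) (n : ℕ) {f : ℝ → ℝ≥0∞} (hf : Measurable f) :
    ∫⁻ ω, ∑' s, genTokens (β ω) n s * f (surprisal (genTokens (β ω) n s)) ∂Pr =
      ∫⁻ y, f y ∂convPow (stepLaw Pr β) n := by
  have := hβ.isProbabilityMeasure_stepLaw
  induction n generalizing f with
  | zero =>
    have h : ∀ ω, ∑' s, genTokens (β ω) 0 s * f (surprisal (genTokens (β ω) 0 s)) = f 0 := by
      intro ω
      rw [tsum_eq_single []]
      · simp [genTokens, surprisal]
      · intro s hs
        rw [genTokens_eq_zero _ 0 s (by simpa using hs), zero_mul]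
    simp_rw [h]
    exact (by simp : ∫⁻ _, f 0 ∂Pr = f 0).trans (lintegral_dirac' 0 hf).symm
  | succ n ih =>
    have hg : Measurable fun y => ∫⁻ x, f (y + x) ∂stepLaw Pr β :=
      Measurable.lintegral_prod_right' (f := fun p : ℝ × ℝ => f (p.1 + p.2)) (by fun_prop)
    -- The induction hypothesis is applied to `f` averaged over one further step, which is why `f`
    -- is generalised.
    rw [lintegral_convPow_succ n hf, ← ih hg]
    simp_rw [tsum_genTokens_succ_mul, genTokens_succ_append]
    have hms := measurable_surprisal
    have hmg := hβ.measurable_genTokens n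
    have hma := hβ.measurable_apply
    rw [lintegral_tsum, lintegral_tsum]
    · refine tsum_congr fun s => ?_
      rw [lintegral_tsum fun v => Measurable.aemeasurable (by fun_prop)]
      simp_rw [hβ.lintegral_genTokens_apply n s _ hf]
      have hinner : ∀ v, Measurable fun y => ∫⁻ ω', β ω' [] v *
          f (y + surprisal (β ω' [] v)) ∂Pr := fun v =>
        Measurable.lintegral_prod_right' (f := fun p : ℝ × Ω =>
          β p.2 [] v * f (p.1 + surprisal (β p.2 [] v))) (by fun_prop)
      refine (lintegral_tsum fun v => Measurable.aemeasurable
        ((hmg s).mul ((hinner v).comp (hms.comp (hmg s))))).symm.trans ?_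
      refine lintegral_congr fun ω => ?_
      refine ENNReal.tsum_mul_left.trans ?_
      congr 1
      exact (hβ.lintegral_stepLaw (f := fun x => f (_ + x)) (by fun_prop)).symm
    · intro s
      exact ((hmg s).mul (hg.comp (hms.comp (hmg s)))).aemeasurable
    · intro s
      refine (Measurable.tsum fun v => ?_).aemeasurable
      fun_prop

lemma lintegral_tsum_nodeProb [Countable V] [IsProbabilityMeasure Pr]
    (hβ : IsIIDTokenTree Pr β) {f : ℝ → ℝ≥0∞} (hf : Measurable f) :
    ∫⁻ ω, ∑' s, nodeProb (β ω) s * f (surprisal (nodeProb (β ω) s)) ∂Pr =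
      ∫⁻ y, f y ∂renewalMeasure (stepLaw Pr β) := by
  have hms := measurable_surprisal
  have h : ∀ ω, ∑' s, nodeProb (β ω) s * f (surprisal (nodeProb (β ω) s)) =
      ∑' n, ∑' s, genTokens (β ω) n s * f (surprisal (genTokens (β ω) n s)) := by
    intro ω
    rw [tsum_nodeProb_mul]
    refine tsum_congr fun n => tsum_congr fun s => ?_
    by_cases hl : s.length = n
    · rw [nodeProb, hl]
    · simp [genTokens_eq_zero _ n s hl]
  simp_rw [h]
  rw [lintegral_tsum, lintegral_renewalMeasure]
  · exact tsum_congr fun n => hβ.lintegral_tsum_genTokens n hf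
  · intro n
    refine (Measurable.tsum fun s => ?_).aemeasurable
    exact (hβ.measurable_genTokens n s).mul (hf.comp (hms.comp (hβ.measurable_genTokens n s)))

end IsIIDTokenTree
end RandomTree
-- Moments of the step law and the bound at a fixed threshold
namespace IsIIDTokenTree

variable {V Ω : Type*} [Countable V] [MeasurableSpace Ω] {Pr : Measure Ω} {β : Ω → TokenTree V}

lemma integrable_sq_stepLaw (hβ : IsIIDTokenTree Pr β)
    (hμ₂ : expectedSecondLogMoment Pr β < ∞) :
    Integrable (fun x => x ^ 2) (stepLaw Pr β) := by
  refine ⟨Measurable.aestronglyMeasurable (by fun_prop), ?_⟩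
  rw [hasFiniteIntegral_iff_ofReal (Filter.Eventually.of_forall fun x => sq_nonneg x),
    hβ.lintegral_ofReal_sq_stepLaw]
  exact hμ₂

lemma integral_stepLaw (hβ : IsIIDTokenTree Pr β) :
    ∫ x, x ∂stepLaw Pr β = (expectedEntropy Pr β).toReal := by
  rw [integral_eq_lintegral_of_nonneg_ae hβ.ae_nonneg_stepLaw
    measurable_id.aestronglyMeasurable, hβ.lintegral_ofReal_stepLaw]

lemma integral_sq_stepLaw (hβ : IsIIDTokenTree Pr β) :
    ∫ x, x ^ 2 ∂stepLaw Pr β = (expectedSecondLogMoment Pr β).toReal := by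
  rw [integral_eq_lintegral_of_nonneg_ae (Filter.Eventually.of_forall fun x => sq_nonneg x)
    (Measurable.aestronglyMeasurable (by fun_prop)), hβ.lintegral_ofReal_sq_stepLaw]

variable [IsProbabilityMeasure Pr]

/-- The second moment controls the first, so the entropy is finite and its `toReal` is not the
default `0`. -/
lemma integral_stepLaw_pos (hβ : IsIIDTokenTree Pr β) (hμ : 0 < expectedEntropy Pr β)
    (hμ₂ : expectedSecondLogMoment Pr β < ∞) : 0 < ∫ x, x ∂stepLaw Pr β := by
  have := hβ.isProbabilityMeasure_stepLaw
  have hint : Integrable (fun x : ℝ => x) (stepLaw Pr β) :=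
    ((memLp_two_iff_integrable_sq measurable_id.aestronglyMeasurable).2
      (hβ.integrable_sq_stepLaw hμ₂)).integrable one_le_two
  have hfin := (hasFiniteIntegral_iff_ofReal hβ.ae_nonneg_stepLaw).1 hint.2
  rw [hβ.lintegral_ofReal_stepLaw] at hfin
  rw [hβ.integral_stepLaw]
  exact ENNReal.toReal_pos hμ.ne' hfin.ne

/-- The bound on the expected number of tokens obtained by counting the excess of the node
probabilities over the threshold `exp (-τ)`. -/
lemma expectedTokens_le (hβ : IsIIDTokenTree Pr β) (hμ : 0 < expectedEntropy Pr β)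
    (hμ₂ : expectedSecondLogMoment Pr β < ∞) {P : ℕ} {draft : TokenTree V → Finset (List V)}
    (hdraft : ∀ u, IsDraftTree P (draft u)) {τ : ℝ} (hτ : 0 ≤ τ) :
    expectedTokens Pr β P draft ≤
      ENNReal.ofReal ((τ - 1 + Real.exp (-τ)) * (1 / ∫ x, x ∂stepLaw Pr β) +
        (∫ x, x ^ 2 ∂stepLaw Pr β) / (∫ x, x ∂stepLaw Pr β) ^ 2 * (1 - Real.exp (-τ)) +
        P * Real.exp (-τ)) := by
  have := hβ.isProbabilityMeasure_stepLaw
  have hpos := hβ.integral_stepLaw_pos hμ hμ₂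
  have hsq : 0 ≤ ∫ x, x ^ 2 ∂stepLaw Pr β := integral_nonneg fun x => sq_nonneg x
  have he1 : 0 ≤ 1 - Real.exp (-τ) := sub_nonneg.2 (Real.exp_le_one_iff.2 (by linarith))
  have he2 : 0 ≤ τ - 1 + Real.exp (-τ) := by linarith [Real.one_sub_le_exp_neg τ]
  calc expectedTokens Pr β P draft
      ≤ ∫⁻ ω, (∑' s, nodeProb (β ω) s * excess τ (surprisal (nodeProb (β ω) s)) +
          ENNReal.ofReal (P * Real.exp (-τ))) ∂Pr :=
        -- The bound is pointwise in the tree, so the drafter need not be measurable.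
        lintegral_mono fun ω => verifExpectation_le (hdraft (β ω)) (β ω) τ
    _ = ∫⁻ y, excess τ y ∂renewalMeasure (stepLaw Pr β) +
          ENNReal.ofReal (P * Real.exp (-τ)) := by
        rw [lintegral_add_right _ measurable_const,
          hβ.lintegral_tsum_nodeProb (measurable_excess τ)]
        simp
    _ ≤ _ := by
        rw [ENNReal.ofReal_add (by positivity) (by positivity)]
        gcongr
        exact lintegral_excess_renewalMeasure_le hβ.ae_nonneg_stepLaw hpos
          (hβ.integrable_sq_stepLaw hμ₂) hτ

end IsIIDTokenTree
end SpecGen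

/-! ### Choice of the threshold -/

theorem mainTheorem1 {V Ω : Type*} [Countable V] [MeasurableSpace Ω]
    (Pr : Measure Ω) [IsProbabilityMeasure Pr]
    (β : Ω → SpecGen.TokenTree V) (hβ : SpecGen.IsIIDTokenTree Pr β)
    (hμ : 0 < SpecGen.expectedEntropy Pr β)
    (hμ₂ : SpecGen.expectedSecondLogMoment Pr β < ∞)
    (μ μ₂ a b : ℝ)
    (hμ_def : μ = (SpecGen.expectedEntropy Pr β).toReal)
    (hμ₂_def : μ₂ = (SpecGen.expectedSecondLogMoment Pr β).toReal)
    (ha : a = (μ + μ₂) / μ ^ 2) (hb : b = 1 - 1 / μ) :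
    (∀ P : ℕ, 1 + μ₂ / μ ^ 2 ≤ (P : ℝ) →
      ∀ draft : SpecGen.TokenTree V → Finset (List V),
        (∀ u, SpecGen.IsDraftTree P (draft u)) →
        SpecGen.expectedTokens Pr β P draft ≤
          ENNReal.ofReal (a * Real.log (((P : ℝ) - b) / a) + a + b)) ∧
    (∃ C : ℝ, ∀ P : ℕ, 1 + μ₂ / μ ^ 2 ≤ (P : ℝ) →
      ∀ draft : SpecGen.TokenTree V → Finset (List V),
        (∀ u, SpecGen.IsDraftTree P (draft u)) →
        SpecGen.expectedTokens Pr β P draft ≤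
          ENNReal.ofReal ((μ + μ₂) / μ ^ 2 * Real.log (P : ℝ) + C)) := by
  have hInt := hβ.integrable_sq_stepLaw hμ₂
  have hE1 := hβ.integral_stepLaw
  have hE2 := hβ.integral_sq_stepLaw
  have hpos := hβ.integral_stepLaw_pos hμ hμ₂
  rw [← hμ_def] at hE1
  rw [← hμ₂_def] at hE2
  rw [hE1] at hpos
  have hμ₂0 : 0 ≤ μ₂ := hμ₂_def ▸ ENNReal.toReal_nonneg
  set k := μ₂ / μ ^ 2 with hk
  have hk0 : 0 ≤ k := by positivity
  have hak : a = 1 / μ + k := by rw [ha, hk]; field_simp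
  have ha0 : 0 < a := by rw [hak]; positivity
  -- The lower bound on `P` is exactly the condition that the chosen `τ` is nonnegative.
  have hone : ∀ P : ℕ, 1 + k ≤ (P : ℝ) → 1 ≤ ((P : ℝ) - b) / a := by
    intro P hP
    rw [one_le_div ha0, hak, hb]
    linarith
  have main : ∀ P : ℕ, 1 + k ≤ (P : ℝ) →
      ∀ draft : SpecGen.TokenTree V → Finset (List V),
        (∀ u, SpecGen.IsDraftTree P (draft u)) →
        SpecGen.expectedTokens Pr β P draft ≤
          ENNReal.ofReal (a * Real.log (((P : ℝ) - b) / a) + a + b) := by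
    intro P hP draft hdraft
    have h1 := hone P hP
    -- With `k * (1 - exp (-τ)) ≤ k * τ` and `exp (-τ) ≤ 1`, the bound is at most `a * τ + b + (P -
    -- b) * exp (-τ)`. This `τ` minimises that expression and makes its last term equal to `a`.
    set τ := Real.log (((P : ℝ) - b) / a) with hτ
    have hτ0 : 0 ≤ τ := Real.log_nonneg h1
    have hPb : 0 < (P : ℝ) - b := by
      rw [one_le_div ha0] at h1
      linarith
    have he : ((P : ℝ) - b) * Real.exp (-τ) = a := by
      rw [Real.exp_neg, hτ, Real.exp_log (by positivity)]
      field_simp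
    have he1 : Real.exp (-τ) ≤ 1 := Real.exp_le_one_iff.2 (by linarith)
    have he2 : 1 - τ ≤ Real.exp (-τ) := Real.one_sub_le_exp_neg τ
    refine (hβ.expectedTokens_le hμ hμ₂ hdraft hτ0).trans (ENNReal.ofReal_le_ofReal ?_)
    rw [hE1, hE2, ← hk]
    have hPe : (P : ℝ) * Real.exp (-τ) = a + b * Real.exp (-τ) := by linarith
    have hkτ : k * (1 - Real.exp (-τ)) ≤ k * τ := mul_le_mul_of_nonneg_left (by linarith) hk0
    rw [hPe, hb]
    nth_rewrite 2 [hak]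
    linarith
  -- The constant comes from `P - b ≤ P * (1 + |b|)`, valid for `P ≥ 1`.
  refine ⟨main, a * Real.log ((1 + |b|) / a) + a + b, fun P hP draft hdraft => ?_⟩
  refine (main P hP draft hdraft).trans (ENNReal.ofReal_le_ofReal ?_)
  have hP1 : 1 ≤ (P : ℝ) := by linarith
  have hlog : Real.log (((P : ℝ) - b) / a) ≤ Real.log P + Real.log ((1 + |b|) / a) := by
    rw [← Real.log_mul (by positivity) (by positivity), mul_div_assoc']
    refine Real.log_le_log (by linarith [hone P hP]) ?_
    gcongr
    nlinarith [neg_abs_le b, abs_nonneg b]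
  rw [← ha]
  linarith [mul_le_mul_of_nonneg_left hlog ha0.le]
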